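/- Let $K$ be a field, $n\ge 0$, and let $A=K[X_1,\dots,X_n]$ with the standard grading and graded maximal ideal $\mathfrak m=(X_1,\dots,X_n)$. A linear form $l\in A$ is filter-regular for a graded $A$-module $M=\bigoplus_d M_d$ if multiplication by $l$ is injective on $M_d$ for all sufficiently large $d$. A sequence $l_1,\dots,l_r$ of linear forms is a filter-regular sequence for $M$ if $l_j$ is filter-regular for $M/(l_1,\dots,l_{j-1})M$ for all $j=1,\dots,r$. A monomial ideal $I$ of $A$ is weakly stable if $X_n,X_{n-1},\dots,X_1$, in this order, is a filter-regular sequence for $A/I$. A finitely generated graded $A$-module is Cohen–Macaulay if it is zero or its depth with respect to $\mathfrak m$ equals its Krull dimension. A finite filtration $0=F_0\subsetneq F_1\subsetneq\cdots\subsetneq F_r=M$ of a finitely generated graded $A$-module $M$ by graded submodules is called a CM filtration if every $F_{i}/F_{i-1}$ is Cohen–Macaulay and $\dim(F_1/F_0)<\dim(F_2/F_1)<\cdots<\dim(F_r/F_{r-1})$; $M$ is sequentially Cohen–Macaulay if it has a CM filtration. **Proposition.** Let $I$ be a weakly stable monomial ideal of $A$. Then $A/I$ is sequentially Cohen–Macaulay.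 Moreover, if $I\neq 0$, put $N_0=I$ and $N_{i+1}=N_i:X_{n-i}^\infty=\{g\in A : X_{n-i}^k g\in N_i \text{ for some } k\ge 0\}$ for $i=0,\dots,n-1$. Then the chain $0=N_0/I\subseteq N_1/I\subseteq\cdots\subseteq N_n/I=A/I$ becomes, after removing repeated terms, a CM filtration of $A/I$. -/

import Mathlib

open MvPolynomial

namespace WeaklyStable

section Graded

variable {K : Type*} [Field K] {n : ℕ}
variable {M : Type*} [AddCommGroup M] [Module K M] [Module (MvPolynomial (Fin n) K) M]

/-- For a graded module `M = ⨁ d, ℳ d` over `A = K[X_1, …, X_n]`, a (linear) form `l` is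
filter-regular for `M` if multiplication by `l` is injective on `ℳ d` for all sufficiently
large `d`. -/
def IsFilterRegular (ℳ : ℕ → Submodule K M) (l : MvPolynomial (Fin n) K) : Prop :=
  ∃ d₀ : ℕ, ∀ d ≥ d₀, Set.InjOn (fun x : M => l • x) (ℳ d)

/-- The pieces of the grading induced on a quotient `M ⧸ N`: the images of the pieces of the
grading of `M`. -/
noncomputable def quotientGrading [IsScalarTower K (MvPolynomial (Fin n) K) M] (ℳ : ℕ → Submodule K M)
    (N : Submodule (MvPolynomial (Fin n) K) M) (d : ℕ) : Submodule K (M ⧸ N) :=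
  (ℳ d).map (N.mkQ.restrictScalars K)

/-- A list `l_1, …, l_r` of linear forms is a filter-regular sequence for `M` if each `l_j` is
filter-regular for `M / (l_1, …, l_{j-1}) M`. -/
def IsFilterRegularSeq [IsScalarTower K (MvPolynomial (Fin n) K) M] (ℳ : ℕ → Submodule K M)
    (ls : List (MvPolynomial (Fin n) K)) : Prop :=
  (∀ l ∈ ls, l.IsHomogeneous 1) ∧
  ∀ (j : ℕ) (hj : j < ls.length),
    IsFilterRegular
      (quotientGrading ℳ
        (Ideal.ofList (ls.take j) • (⊤ : Submodule (MvPolynomial (Fin n) K) M)))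
      ls[j]

/-- A submodule of a graded module is graded if it is generated by homogeneous elements. -/
def IsGradedSubmodule (ℳ : ℕ → Submodule K M) (N : Submodule (MvPolynomial (Fin n) K) M) : Prop :=
  N = Submodule.span (MvPolynomial (Fin n) K) {x | x ∈ N ∧ ∃ d, x ∈ ℳ d}

end Graded

section CohenMacaulay

variable (K : Type*) [Field K] (n : ℕ)
variable (M : Type*) [AddCommGroup M] [Module (MvPolynomial (Fin n) K) M]

/-- The depth of `M` with respect to the graded maximal ideal `(X_1, …, X_n)` of
`K[X_1, …, X_n]`: the supremum of the lengths of `M`-regular sequences in that ideal. -/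
noncomputable def depth : ℕ∞ :=
  ⨆ rs : {rs : List (MvPolynomial (Fin n) K) //
    RingTheory.Sequence.IsRegular M rs ∧ ∀ r ∈ rs, r ∈ idealOfVars (Fin n) K},
    (rs.1.length : ℕ∞)

/-- A finitely generated graded `K[X_1, …, X_n]`-module is Cohen–Macaulay if it is zero or its
depth (with respect to the graded maximal ideal) equals its Krull dimension. -/
def IsCohenMacaulay : Prop :=
  Subsingleton M ∨ (depth K n M : WithBot ℕ∞) = Module.supportDim (MvPolynomial (Fin n) K) M

end CohenMacaulay

section Sequentially

variable {K : Type*} [Field K] {n : ℕ}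
variable {M : Type*} [AddCommGroup M] [Module K M] [Module (MvPolynomial (Fin n) K) M]

/-- A finite strictly increasing filtration `0 = F_0 ⊂ F_1 ⊂ ⋯ ⊂ F_r = M` by graded submodules
such that every `F_{i+1} / F_i` is Cohen–Macaulay and
`dim (F_1 / F_0) < dim (F_2 / F_1) < ⋯ < dim (F_r / F_{r-1})`. -/
structure IsCMFiltration (ℳ : ℕ → Submodule K M) {r : ℕ}
    (F : Fin (r + 1) → Submodule (MvPolynomial (Fin n) K) M) : Prop where
  zero_eq : F 0 = ⊥
  last_eq : F (Fin.last r) = ⊤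
  strictMono : StrictMono F
  graded : ∀ i, IsGradedSubmodule ℳ (F i)
  cohenMacaulay : ∀ i : Fin r,
    IsCohenMacaulay K n (F i.succ ⧸ (F i.castSucc).submoduleOf (F i.succ))
  dim_strictMono : StrictMono fun i : Fin r =>
    Module.supportDim (MvPolynomial (Fin n) K)
      (F i.succ ⧸ (F i.castSucc).submoduleOf (F i.succ))

end Sequentially

/-- A finitely generated graded `K[X_1, …, X_n]`-module is sequentially Cohen–Macaulay if it has a filtration as
in `IsCMFiltration`. -/
def IsSequentiallyCM {K : Type*} [Field K] (n : ℕ) {M : Type*} [AddCommGroup M] [Module K M]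
    [Module (MvPolynomial (Fin n) K) M] (ℳ : ℕ → Submodule K M) : Prop :=
  ∃ (r : ℕ) (F : Fin (r + 1) → Submodule (MvPolynomial (Fin n) K) M), IsCMFiltration ℳ F

section Ideals

variable {K : Type*} [Field K] {n : ℕ}

/-- The standard grading of `A / I`, where `A = K[X_1, …, X_n]`: the piece of degree `d`
consists of the classes of the homogeneous polynomials of degree `d`. -/
noncomputable def stdGrading (I : Ideal (MvPolynomial (Fin n) K)) :
    ℕ → Submodule K (MvPolynomial (Fin n) K ⧸ I) :=
  quotientGrading (homogeneousSubmodule (Fin n) K) I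

/-- A monomial ideal is an ideal generated by monomials. -/
def IsMonomialIdeal (I : Ideal (MvPolynomial (Fin n) K)) : Prop :=
  ∃ S : Set (Fin n →₀ ℕ), I = Ideal.span ((fun s => monomial s (1 : K)) '' S)

/-- A monomial ideal `I` of `K[X_1, …, X_n]` is weakly stable if `X_n, …, X_1` (in this order) is a
filter-regular sequence for `A / I`. Here `X_j` is `X (j - 1)`, with `j - 1 : Fin n`. -/
def IsWeaklyStable (I : Ideal (MvPolynomial (Fin n) K)) : Prop :=
  IsMonomialIdeal I ∧
    IsFilterRegularSeq (stdGrading I)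
      (List.ofFn fun i : Fin n => (X i.rev : MvPolynomial (Fin n) K))

/-- The saturation `J : f^∞ = {g | f^k * g ∈ J for some k}`. -/
def saturation {R : Type*} [CommRing R] (J : Ideal R) (f : R) : Ideal R where
  carrier := {g | ∃ k : ℕ, f ^ k * g ∈ J}
  zero_mem' := ⟨0, by simp⟩
  add_mem' := by
    rintro a b ⟨k, hk⟩ ⟨l, hl⟩
    refine ⟨k + l, ?_⟩
    have h : f ^ (k + l) * (a + b) = f ^ l * (f ^ k * a) + f ^ k * (f ^ l * b) := by ring
    rw [h]
    exact J.add_mem (J.mul_mem_left _ hk) (J.mul_mem_left _ hl)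
  smul_mem' := by
    rintro c a ⟨k, hk⟩
    refine ⟨k, ?_⟩
    have h : f ^ k * (c • a) = c * (f ^ k * a) := by
      rw [smul_eq_mul]
      ring
    rw [h]
    exact J.mul_mem_left _ hk

/-- The successive saturations `N_0 = I` and `N_{i+1} = N_i : X_{n-i}^∞` for `i = 0, …, n - 1`. -/
noncomputable def satChain (I : Ideal (MvPolynomial (Fin n) K)) :
    Fin (n + 1) → Ideal (MvPolynomial (Fin n) K) :=
  Fin.induction (motive := fun _ => Ideal (MvPolynomial (Fin n) K)) I
    (fun i N => saturation N (X i.rev))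

end Ideals

end WeaklyStable

/-! Each $N_i$ is a monomial ideal, and the last $i$ variables are nonzerodivisors modulo both $N_i$
and $N_{i+1}$. On $N_{i+1}/N_i$ they form a regular sequence as soon as this quotient is nonzero
(`isRegular_map_X`). Weak stability makes all other variables nilpotent on it
(`IsWeaklyStable.exists_X_pow_mul_mem`), so its dimension is at most $i$. As depth never exceeds
dimension, both equal $i$: a nonzero quotient is Cohen–Macaulay of dimension equal to its index, and
the dimensions increase along the chain.

Nilpotency rests on `IsWeaklyStable.exists_monomial_mem_of_satChain`: monomials of large degree in
$N_{i+1}$ that avoid the last $i$ variables already lie in $I$. -/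

namespace WeaklyStable

/-! ### Bounds on the dimension of the support -/

section Dimension

open RingTheory.Sequence in
/-- The length of a regular sequence is at most the dimension of the support. -/
theorem length_le_supportDim_of_isRegular {R : Type*} [CommRing R] (rs : List R) :
    ∀ (M : Type*) [AddCommGroup M] [Module R M] [Module.Finite R M], IsRegular M rs →
      (rs.length : WithBot ℕ∞) ≤ Module.supportDim R M := by
  induction rs with
  | nil =>
    intro M _ _ _ h
    have : Nontrivial M := h.nontrivial
    rw [Module.supportDim_eq_ringKrullDim_quotient_annihilator]
    have : Nontrivial (R ⧸ Module.annihilator R M) := by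
      rw [Ideal.Quotient.nontrivial_iff, Ne, Module.annihilator_eq_top_iff]
      exact not_subsingleton M
    simpa using ringKrullDim_nonneg_of_nontrivial
  | cons r rs ih =>
    intro M _ _ _ h
    obtain ⟨h1, h2⟩ := (isRegular_cons_iff M r rs).1 h
    calc ((r :: rs).length : WithBot ℕ∞) = rs.length + 1 := by simp
      _ ≤ Module.supportDim R (QuotSMulTop r M) + 1 := by gcongr; exact ih _ h2
      _ ≤ _ := Module.supportDim_quotSMulTop_succ_le_of_notMem_minimalPrimes
        fun _ => h1.notMem_of_mem_minimalPrimes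

/-- If all variables outside `T` act nilpotently on `M`, then the support of `M` has dimension at
most the cardinality of `T`. -/
theorem supportDim_le_card_of_X_mem_radical {K σ : Type*} [Field K] [Finite σ] (T : Set σ)
    (M : Type*) [AddCommGroup M] [Module (MvPolynomial σ K) M] [Module.Finite (MvPolynomial σ K) M]
    (h : ∀ j ∉ T, (X j : MvPolynomial σ K) ∈ (Module.annihilator (MvPolynomial σ K) M).radical) :
    Module.supportDim (MvPolynomial σ K) M ≤ Nat.card T := by
  let J : Ideal (MvPolynomial σ K) := Ideal.span (X '' Tᶜ)
  have hle : Module.supportDim (MvPolynomial σ K) M ≤ ringKrullDim (MvPolynomial σ K ⧸ J) := by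
    rw [ringKrullDim_quotient, Module.supportDim]
    refine Order.krullDim_le_of_strictMono (fun p => ⟨p.1, ?_⟩) fun {_ _} hlt => hlt
    have hp := p.2
    simp only [Module.support_eq_zeroLocus] at hp
    have hrad := p.1.2.radical_le_iff.2 hp
    simp only [J, PrimeSpectrum.zeroLocus_span]
    rintro _ ⟨j, hj, rfl⟩
    exact hrad (h j hj)
  -- The support lies in $V(J)$, and $A/J$ is a quotient of the polynomial ring in the variables of
  -- `T`.
  let g : MvPolynomial T K →ₐ[K] MvPolynomial σ K ⧸ J :=
    (Ideal.Quotient.mkₐ K J).comp (rename Subtype.val)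
  have hg : Function.Surjective g := by
    intro y
    obtain ⟨p, rfl⟩ := Ideal.Quotient.mkₐ_surjective K J y
    change _ ∈ g.range
    induction p using MvPolynomial.induction_on with
    | C a =>
      rw [← algebraMap_eq, AlgHom.commutes]
      exact g.range.algebraMap_mem a
    | add p q hp hq => rw [map_add]; exact add_mem hp hq
    | mul_X p j hp =>
      rw [map_mul]
      refine mul_mem hp ?_
      by_cases hj : j ∈ T
      · exact ⟨X ⟨j, hj⟩, by simp [g]⟩
      · have : Ideal.Quotient.mkₐ K J (X j) = 0 :=
          Ideal.Quotient.eq_zero_iff_mem.2 (Ideal.subset_span ⟨j, hj, rfl⟩)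
        rw [this]
        exact zero_mem _
  refine hle.trans ((ringKrullDim_le_of_surjective g.toRingHom hg).trans ?_)
  rw [MvPolynomial.ringKrullDim_of_isNoetherianRing, ringKrullDim_eq_zero_of_field, zero_add]

end Dimension

/-! ### Regular sequences of variables on quotients of monomial ideals -/

section MonomialIdeals

variable {K σ : Type*} [Field K]

/-- An ideal of a polynomial ring that contains all the monomials of each of its elements. -/
def HasMonomials (N : Ideal (MvPolynomial σ K)) : Prop :=
  ∀ f ∈ N, ∀ a ∈ f.support, monomial a (1 : K) ∈ N

theorem mem_of_forall_monomial_mem {N : Ideal (MvPolynomial σ K)} {f : MvPolynomial σ K}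
    (h : ∀ a ∈ f.support, monomial a (1 : K) ∈ N) : f ∈ N := by
  rw [f.as_sum]
  refine N.sum_mem fun a ha => ?_
  have : monomial a (f.coeff a) = C (f.coeff a) * monomial a 1 := by simp [C_mul_monomial]
  rw [this]
  exact N.mul_mem_left _ (h a ha)

theorem hasMonomials_top : HasMonomials (⊤ : Ideal (MvPolynomial σ K)) :=
  fun _ _ _ _ => Submodule.mem_top

theorem monomial_mem_of_le {N : Ideal (MvPolynomial σ K)} {a b : σ →₀ ℕ} (hab : a ≤ b)
    (h : monomial a (1 : K) ∈ N) : monomial b (1 : K) ∈ N := by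
  have : monomial b (1 : K) = monomial (b - a) 1 * monomial a 1 := by
    rw [monomial_mul, one_mul, tsub_add_cancel_of_le hab]
  rw [this]
  exact N.mul_mem_left _ h

theorem X_pow_mul_monomial (j : σ) (k : ℕ) (a : σ →₀ ℕ) :
    (X j : MvPolynomial σ K) ^ k * monomial a 1 = monomial (a + Finsupp.single j k) 1 := by
  rw [X_pow_eq_monomial, monomial_mul, one_mul, add_comm]

theorem X_mul_monomial (j : σ) (a : σ →₀ ℕ) :
    (X j : MvPolynomial σ K) * monomial a 1 = monomial (a + Finsupp.single j 1) 1 := by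
  simpa using X_pow_mul_monomial (K := K) j 1 a

theorem add_single_mem_support_X_pow_mul (j : σ) (k : ℕ) (f : MvPolynomial σ K) {a : σ →₀ ℕ}
    (ha : a ∈ f.support) : a + Finsupp.single j k ∈ (X j ^ k * f).support := by
  rw [X_pow_eq_monomial, mem_support_iff, add_comm, coeff_monomial_mul]
  simpa using ha

theorem add_single_mem_support_X_mul (j : σ) (f : MvPolynomial σ K) {a : σ →₀ ℕ}
    (ha : a ∈ f.support) : a + Finsupp.single j 1 ∈ (X j * f).support := by
  simpa using add_single_mem_support_X_pow_mul j 1 f ha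

/-- The monomials of elements of `N + (X_s : s ∈ L) N'` for `N` and `N'` generated by monomials. -/
theorem monomial_of_mem_sup_ofList_mul {N N' : Ideal (MvPolynomial σ K)} (hN : HasMonomials N)
    (hN' : HasMonomials N') (L : List σ) {f : MvPolynomial σ K}
    (hf : f ∈ N ⊔ Ideal.ofList (L.map X) * N') {a : σ →₀ ℕ} (ha : a ∈ f.support) :
    monomial a (1 : K) ∈ N ∨
      ∃ s ∈ L, ∃ b, a = b + Finsupp.single s 1 ∧ monomial b (1 : K) ∈ N' := by
  classical
  -- `S` is closed under enlarging exponents, so the exponents of elements of `W` stay in `S`.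
  let S : Set (σ →₀ ℕ) := {a | monomial a (1 : K) ∈ N ∨
      ∃ s ∈ L, ∃ b, a = b + Finsupp.single s 1 ∧ monomial b (1 : K) ∈ N'}
  let W : Ideal (MvPolynomial σ K) := Ideal.span ((fun a => monomial a (1 : K)) '' S)
  have hW : ∀ g, (∀ a ∈ g.support, a ∈ S) → g ∈ W := fun g hg =>
    mem_ideal_span_monomial_image.2 fun a ha => ⟨a, hg a ha, le_rfl⟩
  have hle : N ⊔ Ideal.ofList (L.map X) * N' ≤ W := by
    refine sup_le (fun g hg => hW g fun a ha => Or.inl (hN g hg a ha)) ?_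
    refine Ideal.mul_le.2 fun r hr g hg => ?_
    unfold Ideal.ofList at hr
    induction hr using Submodule.span_induction with
    | mem r hr =>
      obtain ⟨s, hs, rfl⟩ := List.mem_map.1 hr
      refine hW _ fun a ha => Or.inr ⟨s, hs, ?_⟩
      rw [support_X_mul, Finset.mem_map] at ha
      obtain ⟨b, hb, rfl⟩ := ha
      exact ⟨b, by simp [add_comm], hN' g hg b hb⟩
    | zero => simp
    | add r r' _ _ ih ih' => rw [add_mul]; exact W.add_mem ih ih'
    | smul c r _ ih => rw [smul_mul_assoc]; exact W.smul_mem c ih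
  obtain ⟨b, hb, hba⟩ := mem_ideal_span_monomial_image.1 (hle hf) a ha
  rcases hb with hb | ⟨s, hs, c, rfl, hc⟩
  · exact Or.inl (monomial_mem_of_le hba hb)
  · refine Or.inr ⟨s, hs, a - Finsupp.single s 1, ?_, monomial_mem_of_le ?_ hc⟩
    · exact (tsub_add_cancel_of_le (le_trans le_add_self hba)).symm
    · exact (le_tsub_iff_right (le_trans le_add_self hba)).2 hba

/-- Membership in `(X_s : s ∈ L) M` for a quotient `M` of an ideal `N'`. -/
theorem mem_ofList_smul_top_iff {N N' : Ideal (MvPolynomial σ K)} {M : Type*} [AddCommGroup M]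
    [Module (MvPolynomial σ K) M] (φ : N' →ₗ[MvPolynomial σ K] M) (hφ : Function.Surjective φ)
    (hker : ∀ y, φ y = 0 ↔ (y : MvPolynomial σ K) ∈ N) (L : List (MvPolynomial σ K)) (y : N') :
    φ y ∈ (Ideal.ofList L • ⊤ : Submodule (MvPolynomial σ K) M) ↔
      (y : MvPolynomial σ K) ∈ N ⊔ Ideal.ofList L * N' := by
  have htop : (⊤ : Submodule (MvPolynomial σ K) M) = Submodule.map φ ⊤ := by
    rw [Submodule.map_top, LinearMap.range_eq_top.2 hφ]
  rw [htop, ← Submodule.map_smul'']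
  constructor
  · rintro ⟨z, hz, hzy⟩
    have h1 := (Submodule.mem_smul_top_iff _ _ _).1 hz
    have h2 : ((y - z : N') : MvPolynomial σ K) ∈ N := (hker _).1 (by rw [map_sub, hzy, sub_self])
    have : (y : MvPolynomial σ K) = (y - z : N') + z := by simp
    rw [this]
    exact Submodule.add_mem_sup h2 h1
  · intro hy
    obtain ⟨g, hg, h, hh, hgh⟩ := Submodule.mem_sup.1 hy
    have hmul : Ideal.ofList L * N' ≤ N' := Ideal.mul_le_right
    have hh' : h ∈ N' := hmul hh
    have hz : φ (y - ⟨h, hh'⟩) = 0 := by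
      rw [hker, Submodule.coe_sub, ← hgh, add_sub_cancel_right]
      exact hg
    rw [map_sub, sub_eq_zero] at hz
    exact ⟨⟨h, hh'⟩, (Submodule.mem_smul_top_iff (Ideal.ofList L) N' ⟨h, hh'⟩).2 hh, hz.symm⟩

/-- `X_j` is a nonzerodivisor modulo `N`. -/
def IsSaturatedAt (N : Ideal (MvPolynomial σ K)) (j : σ) : Prop :=
  ∀ f, X j * f ∈ N → f ∈ N

/-- The regularity step on $N'/N$, checked on monomials: if $X_j x^a = X_s x^b$ with $s \ne j$, then
$X_j$ divides $x^b$ and can be cancelled there because $N'$ is saturated at $j$. -/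
theorem X_mul_mem_sup_ofList_mul {N N' : Ideal (MvPolynomial σ K)} (hN : HasMonomials N)
    (hN' : HasMonomials N') (L : List σ) {j : σ} (hjL : j ∉ L) (hj : IsSaturatedAt N j)
    (hj' : IsSaturatedAt N' j) {f : MvPolynomial σ K}
    (hf : X j * f ∈ N ⊔ Ideal.ofList (L.map X) * N') : f ∈ N ⊔ Ideal.ofList (L.map X) * N' := by
  refine mem_of_forall_monomial_mem fun a ha => ?_
  rcases monomial_of_mem_sup_ofList_mul hN hN' L hf (add_single_mem_support_X_mul j f ha) with
    h | ⟨s, hs, b, hab, hb⟩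
  · rw [← X_mul_monomial] at h
    exact Submodule.mem_sup_left (hj _ h)
  · have hsj : j ≠ s := fun h => hjL (h ▸ hs)
    have has : Finsupp.single s 1 ≤ a := by
      have := DFunLike.congr_fun hab s
      rw [Finsupp.single_le_iff]
      simp [hsj] at this
      omega
    have hb' : b = (a - Finsupp.single s 1) + Finsupp.single j 1 := by
      apply add_right_cancel (b := Finsupp.single s 1)
      rw [← hab, add_right_comm, tsub_add_cancel_of_le has]
    rw [hb', ← X_mul_monomial] at hb
    rw [← tsub_add_cancel_of_le has, ← X_mul_monomial]
    exact Submodule.mem_sup_right (Ideal.mul_mem_mul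
      (Ideal.subset_span (List.mem_map_of_mem hs)) (hj' _ hb))

theorem IsSaturatedAt.monomial_erase [DecidableEq σ] {N : Ideal (MvPolynomial σ K)} {j : σ}
    (h : IsSaturatedAt N j) {a : σ →₀ ℕ} (ha : monomial a (1 : K) ∈ N) :
    monomial (a.erase j) (1 : K) ∈ N := by
  rw [← Finsupp.erase_add_single j a, ← X_pow_mul_monomial] at ha
  generalize a j = k at ha
  induction k with
  | zero => simpa using ha
  | succ k ih =>
    rw [pow_succ', mul_assoc] at ha
    exact ih (h _ ha)

/-- Setting to zero the exponents of variables that are nonzerodivisors. -/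
theorem IsSaturatedAt.monomial_filter [DecidableEq σ] {N : Ideal (MvPolynomial σ K)} (L : List σ)
    (h : ∀ j ∈ L, IsSaturatedAt N j) {a : σ →₀ ℕ} (ha : monomial a (1 : K) ∈ N) :
    monomial (a.filter (· ∉ L)) (1 : K) ∈ N := by
  induction L with
  | nil =>
    have : a.filter (· ∉ ([] : List σ)) = a := by ext i; simp
    rwa [this]
  | cons j L ih =>
    have h1 := (h j (by simp)).monomial_erase (ih fun i hi => h i (by simp [hi]))
    have : a.filter (· ∉ j :: L) = (a.filter (· ∉ L)).erase j := by
      ext i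
      by_cases hij : i = j
      · subst hij; simp
      · simp [Finsupp.filter_apply, Finsupp.erase_ne hij, hij]
    rwa [this]

/-- The map `φ` presents `M` as $N'/N$. This form also covers quotients of ideals of $A/I$, which
are only isomorphic to $N'/N$. -/
theorem isRegular_map_X [DecidableEq σ] {N N' : Ideal (MvPolynomial σ K)} (hle : N < N') (hN : HasMonomials N)
    (hN' : HasMonomials N') (L : List σ) (hL : L.Nodup) (hj : ∀ j ∈ L, IsSaturatedAt N j)
    (hj' : ∀ j ∈ L, IsSaturatedAt N' j) {M : Type*} [AddCommGroup M]
    [Module (MvPolynomial σ K) M] (φ : N' →ₗ[MvPolynomial σ K] M) (hφ : Function.Surjective φ)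
    (hker : ∀ y, φ y = 0 ↔ (y : MvPolynomial σ K) ∈ N) :
    RingTheory.Sequence.IsRegular M (L.map (X : σ → MvPolynomial σ K)) where
  regular_mod_prev i hi := by
    rw [isSMulRegular_iff_right_eq_zero_of_smul]
    intro x hx
    obtain ⟨x, rfl⟩ := Submodule.Quotient.mk_surjective _ x
    obtain ⟨y, rfl⟩ := hφ x
    rw [← Submodule.Quotient.mk_smul, ← map_smul, Submodule.Quotient.mk_eq_zero, ← List.map_take,
      mem_ofList_smul_top_iff φ hφ hker] at hx
    rw [Submodule.Quotient.mk_eq_zero, ← List.map_take, mem_ofList_smul_top_iff φ hφ hker]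
    have hi' : i < L.length := by simpa using hi
    refine X_mul_mem_sup_ofList_mul hN hN' (L.take i) (j := L[i]) ?_ (hj _ (by simp))
      (hj' _ (by simp)) (by simpa using hx)
    intro hmem
    obtain ⟨k, hk, hki⟩ := List.mem_take_iff_getElem.1 hmem
    have := (hL.getElem_inj_iff).1 hki
    omega
  top_ne_smul htop := by
    obtain ⟨f, hf', hf⟩ := SetLike.exists_of_lt hle
    obtain ⟨a, ha, haN⟩ : ∃ a ∈ f.support, monomial a (1 : K) ∉ N := by
      by_contra! h
      exact hf (mem_of_forall_monomial_mem h)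
    -- Stripped of the variables in `L`, the monomial stays in $N'$ but is too small for $(X_s : s
    -- \in L)N'$. It would have to lie in $N$, and so would $x^a$.
    have hb := IsSaturatedAt.monomial_filter L hj' (hN' f hf' a ha)
    have h1 : φ ⟨_, hb⟩ ∈ (Ideal.ofList (L.map X) • ⊤ : Submodule (MvPolynomial σ K) M) :=
      htop ▸ Submodule.mem_top
    rw [mem_ofList_smul_top_iff φ hφ hker] at h1
    rcases monomial_of_mem_sup_ofList_mul hN hN' L h1 (a := a.filter (· ∉ L)) (by simp) with
      h | ⟨s, hs, b, hab, -⟩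
    · refine haN (monomial_mem_of_le (fun i => ?_) h)
      rw [Finsupp.filter_apply]
      split_ifs <;> simp
    · have := DFunLike.congr_fun hab s
      simp [hs] at this

/-- The depth and the dimension of a quotient `M = N' / N` of monomial ideals such that the
variables in `L` are nonzerodivisors modulo `N` and `N'` and the others are nilpotent on `M`. -/
theorem depth_and_supportDim_eq_length {n : ℕ} {N N' : Ideal (MvPolynomial (Fin n) K)}
    (hle : N < N') (hN : HasMonomials N)
    (hN' : HasMonomials N') (L : List (Fin n)) (hL : L.Nodup) (hj : ∀ j ∈ L, IsSaturatedAt N j)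
    (hj' : ∀ j ∈ L, IsSaturatedAt N' j)
    (hnil : ∀ j ∉ L, ∃ k : ℕ, ∀ f ∈ N', X j ^ k * f ∈ N) {M : Type*} [AddCommGroup M]
    [Module (MvPolynomial (Fin n) K) M] (φ : N' →ₗ[MvPolynomial (Fin n) K] M)
    (hφ : Function.Surjective φ)
    (hker : ∀ y, φ y = 0 ↔ (y : MvPolynomial (Fin n) K) ∈ N) :
    depth K n M = L.length ∧ Module.supportDim (MvPolynomial (Fin n) K) M = L.length := by
  have hfin : Module.Finite (MvPolynomial (Fin n) K) M := Module.Finite.of_surjective φ hφ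
  have hreg := isRegular_map_X hle hN hN' L hL hj hj' φ hφ hker
  have hdim : Module.supportDim (MvPolynomial (Fin n) K) M ≤ L.length := by
    have hcard : Nat.card {j | j ∈ L} = L.length := by
      have : {j | j ∈ L} = (L.toFinset : Set (Fin n)) := by ext; simp
      rw [this, Nat.card_coe_set_eq, Set.ncard_coe_finset, List.toFinset_card_of_nodup hL]
    rw [← hcard]
    refine supportDim_le_card_of_X_mem_radical {j | j ∈ L} M fun j hjL => ?_
    obtain ⟨k, hk⟩ := hnil j hjL
    refine ⟨k, Module.mem_annihilator.2 fun m => ?_⟩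
    obtain ⟨y, rfl⟩ := hφ m
    rw [← map_smul, hker]
    exact hk y y.2
  have hlow : ∀ rs : List (MvPolynomial (Fin n) K), RingTheory.Sequence.IsRegular M rs →
      rs.length ≤ L.length := fun rs hrs => by
    exact_mod_cast (length_le_supportDim_of_isRegular rs M hrs).trans hdim
  refine ⟨le_antisymm (iSup_le fun rs => by exact_mod_cast hlow rs.1 rs.2.1) ?_,
    le_antisymm hdim ?_⟩
  · refine le_trans ?_ (le_iSup _ ⟨L.map X, hreg, fun r hr => ?_⟩)
    · simp
    · obtain ⟨j, -, rfl⟩ := List.mem_map.1 hr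
      exact Ideal.subset_span ⟨j, rfl⟩
  · simpa using length_le_supportDim_of_isRegular _ M hreg

end MonomialIdeals

/-! ### Removing repetitions from a chain -/

section Chains

/-- Removing the repetitions from a finite chain. -/
theorem exists_strictMono_range_eq {α : Type*} [PartialOrder α] :
    ∀ {n : ℕ} (f : Fin (n + 1) → α), Monotone f →
      ∃ (r : ℕ) (F : Fin (r + 1) → α) (k : Fin r → Fin n), StrictMono F ∧ StrictMono k ∧
        F 0 = f 0 ∧ F (Fin.last r) = f (Fin.last n) ∧ Set.range F = Set.range f ∧
        (∀ i, F i.castSucc = f (k i).castSucc) ∧ ∀ i, F i.succ = f (k i).succ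
  | 0, f, _ => ⟨0, f, Fin.elim0, fun i j h => absurd h (by rw [Subsingleton.elim (α := Fin 1) i j]; exact lt_irrefl _),
      fun i => i.elim0, rfl, rfl, rfl,
      fun i => i.elim0, fun i => i.elim0⟩
  | n + 1, f, hf => by
    obtain ⟨r, F, k, hF, hk, h0, hlast, hrange, h1, h2⟩ :=
      exists_strictMono_range_eq (fun i => f i.castSucc) (hf.comp Fin.strictMono_castSucc.monotone)
    have hrf : Set.range f = insert (f (Fin.last (n + 1))) (Set.range fun i : Fin (n + 1) => f i.castSucc) := by
      ext x
      simp only [Set.mem_range, Set.mem_insert_iff, Fin.exists_fin_succ', eq_comm, or_comm]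
    have hkc : StrictMono fun i => (k i).castSucc := Fin.strictMono_castSucc.comp hk
    -- The map `k` records where the original chain jumps; these indices later become the dimensions
    -- of the quotients.
    rcases (hf (Fin.last n).castSucc_lt_last.le).eq_or_lt with h | h
    · refine ⟨r, F, fun i => (k i).castSucc, hF, hkc, h0, hlast.trans h, ?_, h1, h2⟩
      rw [hrange, hrf, Set.insert_eq_of_mem]
      exact ⟨_, h⟩
    · refine ⟨r + 1, Fin.snoc (α := fun _ => α) F (f (Fin.last (n + 1))),
        Fin.snoc (α := fun _ => Fin (n + 1)) (fun i => (k i).castSucc) (Fin.last n),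
        ?_, ?_, ?_, by simp, ?_, ?_, ?_⟩
      · refine Fin.strictMono_iff_lt_succ.2 fun i => ?_
        induction i using Fin.lastCases with
        | last => simpa [hlast] using h
        | cast i =>
          rw [← Fin.castSucc_succ, Fin.snoc_castSucc, Fin.snoc_castSucc]
          exact hF i.castSucc_lt_succ
      · intro i j hij
        induction j using Fin.lastCases with
        | last =>
          induction i using Fin.lastCases with
          | last => exact absurd hij (lt_irrefl _)
          | cast i => simp [Fin.castSucc_lt_last]
        | cast j =>
          induction i using Fin.lastCases with
          | last => exact absurd (hij.trans j.castSucc_lt_last) (lt_irrefl _)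
          | cast i => simpa using hk (by simpa using hij)
      · rw [← Fin.castSucc_zero, Fin.snoc_castSucc, h0, Fin.castSucc_zero]
      · rw [Fin.range_snoc, hrange, hrf]
      · intro i
        induction i using Fin.lastCases with
        | last => simp [hlast]
        | cast i => simp [h1]
      · intro i
        induction i using Fin.lastCases with
        | last => simp
        | cast i => rw [← Fin.castSucc_succ, Fin.snoc_castSucc, Fin.snoc_castSucc, h2]; rfl

end Chains

/-! ### The saturation chain and weak stability -/

section Saturation

variable {K : Type*} [Field K] {n : ℕ}

theorem IsMonomialIdeal.hasMonomials {I : Ideal (MvPolynomial (Fin n) K)}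
    (hI : IsMonomialIdeal I) : HasMonomials I := by
  obtain ⟨S, rfl⟩ := hI
  intro f hf a ha
  obtain ⟨b, hb, hba⟩ := mem_ideal_span_monomial_image.1 hf a ha
  exact monomial_mem_of_le hba (Ideal.subset_span ⟨b, hb, rfl⟩)

theorem le_saturation {R : Type*} [CommRing R] (J : Ideal R) (f : R) : J ≤ saturation J f :=
  fun g hg => ⟨0, by simpa using hg⟩

theorem HasMonomials.saturation {N : Ideal (MvPolynomial (Fin n) K)} (hN : HasMonomials N)
    (j : Fin n) : HasMonomials (saturation N (X j)) := by
  rintro f ⟨k, hk⟩ a ha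
  refine ⟨k, ?_⟩
  rw [X_pow_mul_monomial]
  exact hN _ hk _ (add_single_mem_support_X_pow_mul j k f ha)

theorem isSaturatedAt_saturation_self (N : Ideal (MvPolynomial (Fin n) K)) (j : Fin n) :
    IsSaturatedAt (saturation N (X j)) j := by
  rintro f ⟨k, hk⟩
  exact ⟨k + 1, by rwa [pow_succ, mul_assoc]⟩

theorem IsSaturatedAt.saturation {N : Ideal (MvPolynomial (Fin n) K)} {j : Fin n}
    (h : IsSaturatedAt N j) (i : Fin n) : IsSaturatedAt (saturation N (X i)) j := by
  rintro f ⟨k, hk⟩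
  exact ⟨k, h _ (by rwa [mul_left_comm])⟩

variable (I : Ideal (MvPolynomial (Fin n) K))

theorem satChain_zero : satChain I 0 = I := rfl

theorem satChain_succ (i : Fin n) :
    satChain I i.succ = saturation (satChain I i.castSucc) (X i.rev) :=
  Fin.induction_succ ..

theorem monotone_satChain : Monotone (satChain I) :=
  Fin.monotone_iff_le_succ.2 fun i => satChain_succ I i ▸ le_saturation _ _

theorem le_satChain (i : Fin (n + 1)) : I ≤ satChain I i := monotone_satChain I (Fin.zero_le i)

variable {I}

theorem hasMonomials_satChain (hI : HasMonomials I) (i : Fin (n + 1)) :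
    HasMonomials (satChain I i) := by
  induction i using Fin.induction with
  | zero => exact hI
  | succ i ih => exact satChain_succ I i ▸ ih.saturation _

/-- With `j` counted from 0, `n ≤ j + i` means that `X j` is among the last `i` variables. Each
saturation adds one nonzerodivisor and keeps the earlier ones, since variables commute. -/
theorem isSaturatedAt_satChain (i : Fin (n + 1)) (j : Fin n) (hj : n ≤ j + i) :
    IsSaturatedAt (satChain I i) j := by
  induction i using Fin.induction with
  | zero => have := j.2; simp at hj; omega
  | succ i ih =>
    rw [satChain_succ]
    by_cases hji : j = i.rev
    · subst hji
      exact isSaturatedAt_saturation_self _ _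
    · refine (ih ?_).saturation _
      have : (j : ℕ) ≠ n - (i + 1) := fun h => hji (Fin.ext (by rw [h, Fin.val_rev]))
      simp at hj ⊢
      omega

/-- The indices of the last `i` variables, from the last one on. -/
def lastVars {i : ℕ} (hi : i ≤ n) : List (Fin n) :=
  List.ofFn fun k : Fin i => (Fin.castLE hi k).rev

theorem length_lastVars {i : ℕ} (hi : i ≤ n) : (lastVars hi).length = i := List.length_ofFn

theorem nodup_lastVars {i : ℕ} (hi : i ≤ n) : (lastVars hi).Nodup :=
  List.nodup_ofFn.2 (Fin.rev_injective.comp (Fin.castLE_injective hi))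

theorem mem_lastVars {i : ℕ} (hi : i ≤ n) {j : Fin n} : j ∈ lastVars hi ↔ n ≤ j + i := by
  rw [lastVars, List.mem_ofFn]
  constructor
  · rintro ⟨k, rfl⟩
    have := k.2
    simp only [Fin.val_rev, Fin.val_castLE]
    omega
  · intro h
    have := j.2
    refine ⟨⟨n - (j + 1), by omega⟩, Fin.ext ?_⟩
    simp only [Fin.val_rev, Fin.val_castLE]
    omega

/-- The consequence of weak stability for monomials without the last `i` variables. -/
theorem IsWeaklyStable.exists_monomial_mem (hI : IsWeaklyStable I) (i : Fin n) :
    ∃ D : ℕ, ∀ a : Fin n →₀ ℕ, D ≤ a.degree → (∀ j : Fin n, n ≤ j + i → a j = 0) →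
      monomial (a + Finsupp.single i.rev 1) (1 : K) ∈ I → monomial a (1 : K) ∈ I := by
  obtain ⟨D, hD⟩ := hI.2.2 i (by simp)
  refine ⟨D, fun a hDa ha haI => ?_⟩
  have htake : (List.ofFn fun i : Fin n => (X i.rev : MvPolynomial (Fin n) K)).take i =
      (lastVars i.2.le).map X := by
    refine List.ext_getElem (by simp [length_lastVars]) fun k hk hk' => ?_
    simp [lastVars]
  have hx : (Submodule.mkQ (Ideal.ofList ((List.ofFn fun i : Fin n =>
      (X i.rev : MvPolynomial (Fin n) K)).take i) •
        (⊤ : Submodule (MvPolynomial (Fin n) K) (MvPolynomial (Fin n) K ⧸ I))))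
      (Submodule.mkQ I (monomial a 1)) = 0 := by
    -- Multiplication by the next variable sends both the class of $x^a$ and 0 to 0, in a degree
    -- where it is injective.
    refine hD _ hDa ⟨_, ⟨monomial a 1, ?_, rfl⟩, rfl⟩ (zero_mem _) ?_
    · exact isHomogeneous_monomial 1 rfl
    · have h0 : Submodule.mkQ I (X i.rev * monomial a 1) = 0 := by
        rw [X_mul_monomial]
        exact (Submodule.Quotient.mk_eq_zero I).2 haI
      simp only [List.getElem_ofFn, smul_zero]
      change (X i.rev : MvPolynomial (Fin n) K) • _ = _
      rw [LinearMap.restrictScalars_apply, LinearMap.restrictScalars_apply, ← map_smul, ← map_smul,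
        smul_eq_mul, h0, map_zero]
  rw [Submodule.mkQ_apply, Submodule.Quotient.mk_eq_zero, htake] at hx
  have hx' := (mem_ofList_smul_top_iff (N := I) (I.mkQ ∘ₗ Submodule.subtype ⊤)
    (fun y => by
      obtain ⟨y, rfl⟩ := I.mkQ_surjective y
      exact ⟨⟨y, trivial⟩, rfl⟩)
    (fun y => Submodule.Quotient.mk_eq_zero I) ((lastVars i.2.le).map X)
    ⟨monomial a 1, trivial⟩).1 hx
  -- Now $x^a \in I + (\text{last } i \text{ variables})$, and $x^a$ involves none of these
  -- variables.
  rcases monomial_of_mem_sup_ofList_mul hI.1.hasMonomials hasMonomials_top (lastVars i.2.le) hx'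
    (a := a) (by simp) with h | ⟨s, hs, b, hab, -⟩
  · exact h
  · have := DFunLike.congr_fun hab s
    rw [ha s ((mem_lastVars _).1 hs)] at this
    simp at this

/-- Only the last $i-1$ variables are excluded, one fewer than the number of saturations. In the
inductive step a power of the newly saturated variable brings $x^a$ into $N_i$, hence into $I$ by
induction; weak stability then cancels that power factor by factor. -/
theorem IsWeaklyStable.exists_monomial_mem_of_satChain (hI : IsWeaklyStable I)
    (i : Fin (n + 1)) :
    ∃ D : ℕ, ∀ a : Fin n →₀ ℕ, D ≤ a.degree → (∀ j : Fin n, n + 1 ≤ j + i → a j = 0) →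
      monomial a (1 : K) ∈ satChain I i → monomial a (1 : K) ∈ I := by
  induction i using Fin.induction with
  | zero => exact ⟨0, fun a _ _ h => h⟩
  | succ i ih =>
    obtain ⟨D, hD⟩ := ih
    obtain ⟨D', hD'⟩ := hI.exists_monomial_mem i
    refine ⟨max D D', fun a hDa ha haN => ?_⟩
    have ha' : ∀ j : Fin n, n ≤ j + i → a j = 0 := fun j hj => ha j (by simp; omega)
    have hmem : ∀ k : ℕ, ∀ j : Fin n, n ≤ j + i → (a + Finsupp.single i.rev k) j = 0 := by
      intro k j hj
      have hne : i.rev ≠ j := by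
        rintro rfl
        simp only [Fin.val_rev] at hj
        omega
      simp [ha' j hj, Finsupp.single_eq_of_ne' hne]
    have hdeg : ∀ k : ℕ, max D D' ≤ (a + Finsupp.single i.rev k).degree := fun k => by
      rw [map_add]; omega
    rw [satChain_succ] at haN
    obtain ⟨k, hk⟩ := haN
    rw [X_pow_mul_monomial] at hk
    replace hk := hD _ ((le_max_left _ _).trans (hdeg k))
      (fun j hj => hmem k j (by simp at hj; omega)) hk
    induction k with
    | zero => simpa using hk
    | succ k ih =>
      refine ih (hD' _ ((le_max_right _ _).trans (hdeg k)) (hmem k) ?_)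
      rwa [add_assoc, ← Finsupp.single_add]

/-- The variables that are not among the last `i` ones are nilpotent on `N_{i+1} / N_i`. -/
theorem IsWeaklyStable.exists_X_pow_mul_mem (hI : IsWeaklyStable I) (i : Fin n) (j : Fin n)
    (hj : ¬ n ≤ j + i) :
    ∃ k : ℕ, ∀ f ∈ satChain I i.succ, X j ^ k * f ∈ satChain I i.castSucc := by
  obtain ⟨D, hD⟩ := hI.exists_monomial_mem_of_satChain i.succ
  refine ⟨D, fun f hf => ?_⟩
  have key : ∀ a ∈ f.support, X j ^ D * monomial a (1 : K) ∈ satChain I i.castSucc := by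
    intro a ha
    -- The last $i$ variables can be removed within $N_{i+1}$. Multiplying by $X_j^D$ then gives
    -- degree at least $D$ without reintroducing them, so the product lies in $I \subseteq N_i$.
    have hsat := IsSaturatedAt.monomial_filter (lastVars i.2.le)
      (fun s hs => isSaturatedAt_satChain (I := I) i.succ s (by
        have := (mem_lastVars _).1 hs
        simp; omega))
      (hasMonomials_satChain hI.1.hasMonomials _ f hf a ha)
    have h1 := hD (a.filter (· ∉ lastVars i.2.le) + Finsupp.single j D) (by simp)
      (fun s hs => by
        have hs' : n ≤ s + i := by simp at hs; omega
        have hne : j ≠ s := by rintro rfl; exact hj hs'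
        simp [mem_lastVars, hs', Finsupp.single_eq_of_ne' hne])
      (monomial_mem_of_le (by simp) hsat)
    rw [X_pow_mul_monomial]
    refine monomial_mem_of_le (add_le_add_left (fun s => ?_) _) (le_satChain I _ h1)
    rw [Finsupp.filter_apply]
    split_ifs <;> simp
  rw [f.as_sum, Finset.mul_sum]
  refine Ideal.sum_mem _ fun a ha => ?_
  have : X j ^ D * monomial a (f.coeff a) = C (f.coeff a) * (X j ^ D * monomial a 1) := by
    rw [mul_left_comm, C_mul_monomial, mul_one]
  rw [this]
  exact Ideal.mul_mem_left _ _ (key a ha)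

/-- All variables are nonzerodivisors modulo $N_n$, so any monomial of $I$ can be stripped down to
1. -/
theorem satChain_last_eq_top (hI : HasMonomials I) (h0 : I ≠ ⊥) :
    satChain I (Fin.last n) = ⊤ := by
  obtain ⟨f, hf, hf0⟩ := Submodule.exists_mem_ne_zero_of_ne_bot h0
  obtain ⟨a, ha⟩ := support_nonempty.2 hf0
  have h := IsSaturatedAt.monomial_filter (List.finRange n)
    (fun s _ => isSaturatedAt_satChain (I := I) (Fin.last n) s (by simp))
    (le_satChain I _ (hI f hf a ha))
  have hfilter : a.filter (· ∉ List.finRange n) = 0 := by ext; simp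
  rw [hfilter] at h
  exact (Ideal.eq_top_iff_one _).2 h

end Saturation

/-! ### The Cohen–Macaulay filtration -/

section Filtration

variable {K : Type*} [Field K] {n : ℕ} {I : Ideal (MvPolynomial (Fin n) K)}

theorem isGradedSubmodule_map_mkQ {N : Ideal (MvPolynomial (Fin n) K)} (hN : HasMonomials N) :
    IsGradedSubmodule (stdGrading I) (Submodule.map (Submodule.mkQ I) N) := by
  refine le_antisymm ?_ (Submodule.span_le.2 fun x hx => hx.1)
  rintro _ ⟨f, hf, rfl⟩
  rw [f.as_sum, map_sum]
  refine Submodule.sum_mem _ fun a ha => Submodule.subset_span ⟨⟨_, ?_, rfl⟩, a.degree, _, ?_, rfl⟩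
  · have := N.mul_mem_left (C (f.coeff a)) (hN f hf a ha)
    rwa [C_mul_monomial, mul_one] at this
  · exact isHomogeneous_monomial _ rfl

/-- The depth and the dimension of a quotient of ideals of `A / I`. -/
theorem depth_and_supportDim_map_mkQ {N N' : Ideal (MvPolynomial (Fin n) K)} (hIN : I ≤ N)
    (hN : HasMonomials N) (hN' : HasMonomials N') {i : ℕ} (hi : i ≤ n)
    (hle : N < N') (hj : ∀ j : Fin n, n ≤ j + i → IsSaturatedAt N j)
    (hj' : ∀ j : Fin n, n ≤ j + i → IsSaturatedAt N' j)
    (hnil : ∀ j : Fin n, ¬ n ≤ j + i → ∃ k : ℕ, ∀ f ∈ N', X j ^ k * f ∈ N)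
    {P Q : Submodule (MvPolynomial (Fin n) K) (MvPolynomial (Fin n) K ⧸ I)}
    (hP : P = Submodule.map (Submodule.mkQ I) N') (hQ : Q = Submodule.map (Submodule.mkQ I) N) :
    depth K n (P ⧸ Q.submoduleOf P) = i ∧
      Module.supportDim (MvPolynomial (Fin n) K) (P ⧸ Q.submoduleOf P) = i := by
  subst hP hQ
  have h := depth_and_supportDim_eq_length hle hN hN' (lastVars hi) (nodup_lastVars hi)
    (fun j h => hj j ((mem_lastVars hi).1 h)) (fun j h => hj' j ((mem_lastVars hi).1 h))
    (fun j h => hnil j (mt (mem_lastVars hi).2 h))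
    (Submodule.mkQ ((Submodule.map (Submodule.mkQ I) N).submoduleOf
      (Submodule.map (Submodule.mkQ I) N')) ∘ₗ (Submodule.mkQ I).submoduleMap N')
    ((Submodule.mkQ_surjective _).comp (LinearMap.submoduleMap_surjective _ _))
    (fun y => by
      rw [LinearMap.comp_apply, Submodule.mkQ_apply, Submodule.Quotient.mk_eq_zero,
        Submodule.submoduleOf, Submodule.mem_comap]
      change I.mkQ (y : MvPolynomial (Fin n) K) ∈ _ ↔ _
      rw [← Submodule.mem_comap, Submodule.comap_map_mkQ, sup_eq_right.2 hIN])
  rwa [length_lastVars] at h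

theorem isCohenMacaulay_of_eq {M : Type*} [AddCommGroup M] [Module (MvPolynomial (Fin n) K) M]
    {i : ℕ} (h : depth K n M = i ∧ Module.supportDim (MvPolynomial (Fin n) K) M = i) :
    IsCohenMacaulay K n M := by
  right
  rw [h.1, h.2]
  rfl

theorem IsWeaklyStable.exists_isCMFiltration (hI : IsWeaklyStable I) (h0 : I ≠ ⊥) :
    ∃ (r : ℕ) (F : Fin (r + 1) →
        Submodule (MvPolynomial (Fin n) K) (MvPolynomial (Fin n) K ⧸ I)),
      IsCMFiltration (stdGrading I) F ∧
      Set.range F = Set.range fun i : Fin (n + 1) =>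
        Submodule.map (Submodule.mkQ I) (satChain I i) := by
  have hmon := hI.1.hasMonomials
  obtain ⟨r, F, k, hF, hk, hF0, hFlast, hrange, h1, h2⟩ := exists_strictMono_range_eq
    (fun i : Fin (n + 1) => Submodule.map (Submodule.mkQ I) (satChain I i))
    fun i j hij => Submodule.map_mono (monotone_satChain I hij)
  have key : ∀ i : Fin r,
      depth K n (F i.succ ⧸ (F i.castSucc).submoduleOf (F i.succ)) = (k i : ℕ) ∧
      Module.supportDim (MvPolynomial (Fin n) K)
        (F i.succ ⧸ (F i.castSucc).submoduleOf (F i.succ)) = (k i : ℕ) := by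
    intro i
    have hlt : satChain I (k i).castSucc < satChain I (k i).succ := by
      refine (monotone_satChain I (k i).castSucc_lt_succ.le).lt_of_ne fun h => ?_
      have := hF i.castSucc_lt_succ
      rw [h1, h2, h] at this
      exact lt_irrefl _ this
    exact depth_and_supportDim_map_mkQ (le_satChain I _) (hasMonomials_satChain hmon _)
      (hasMonomials_satChain hmon _) (k i).2.le hlt
      (fun j hj => isSaturatedAt_satChain _ j (by simpa using hj))
      (fun j hj => isSaturatedAt_satChain _ j (by simp; omega))
      (hI.exists_X_pow_mul_mem (k i)) (h2 i) (h1 i)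
  refine ⟨r, F, ⟨?_, ?_, hF, fun i => ?_, fun i => isCohenMacaulay_of_eq (key i), ?_⟩, hrange⟩
  · rw [hF0, satChain_zero, Submodule.mkQ_map_self]
  · rw [hFlast, satChain_last_eq_top hmon h0, Submodule.map_top, Submodule.range_mkQ]
  · obtain ⟨j, hj⟩ := hrange ▸ Set.mem_range_self i
    rw [← hj]
    exact isGradedSubmodule_map_mkQ (hasMonomials_satChain hmon j)
  -- The dimensions are the jump indices `k i`, which strictly increase.
  · intro i j hij
    simp only [(key _).2]
    exact_mod_cast hk hij

/-- Saturating 0 never leaves 0, so the one-step filtration $0 \subset A$ is used instead. -/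
theorem isSequentiallyCM_bot :
    IsSequentiallyCM n (stdGrading (⊥ : Ideal (MvPolynomial (Fin n) K))) := by
  have hbot : HasMonomials (⊥ : Ideal (MvPolynomial (Fin n) K)) := by
    rintro f hf a ha
    simp [(Submodule.mem_bot _).1 hf] at ha
  have hmap0 : (⊥ : Submodule (MvPolynomial (Fin n) K)
      (MvPolynomial (Fin n) K ⧸ (⊥ : Ideal (MvPolynomial (Fin n) K)))) =
      Submodule.map (Submodule.mkQ ⊥) ⊥ := by simp
  have hmap1 : (⊤ : Submodule (MvPolynomial (Fin n) K)
      (MvPolynomial (Fin n) K ⧸ (⊥ : Ideal (MvPolynomial (Fin n) K)))) =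
      Submodule.map (Submodule.mkQ ⊥) ⊤ := by simp
  refine ⟨1, ![⊥, ⊤], rfl, rfl, ?_, ?_, ?_, Subsingleton.strictMono _⟩
  · refine Fin.strictMono_iff_lt_succ.2 fun i => ?_
    fin_cases i
    have : Nontrivial (MvPolynomial (Fin n) K ⧸ (⊥ : Ideal (MvPolynomial (Fin n) K))) :=
      Ideal.Quotient.nontrivial_iff.2 bot_ne_top
    exact bot_lt_top
  · intro i
    fin_cases i
    · exact hmap0 ▸ isGradedSubmodule_map_mkQ hbot
    · exact hmap1 ▸ isGradedSubmodule_map_mkQ hasMonomials_top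
  · intro i
    fin_cases i
    -- This is the case $i = n$: all variables form the regular sequence and the nilpotency
    -- condition is vacuous.
    exact isCohenMacaulay_of_eq (depth_and_supportDim_map_mkQ le_rfl hbot hasMonomials_top le_rfl
      bot_lt_top (fun j _ f hf => by simpa using hf) (fun _ _ _ _ => trivial)
      (fun j hj => absurd (Nat.le_add_left n j) hj) hmap1 hmap0)

end Filtration

end WeaklyStable

theorem mainTheorem8 {K : Type*} [Field K] {n : ℕ} (I : Ideal (MvPolynomial (Fin n) K))
    (hI : WeaklyStable.IsWeaklyStable I) :
    WeaklyStable.IsSequentiallyCM n (WeaklyStable.stdGrading I) ∧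
    (I ≠ ⊥ →
      ∃ (r : ℕ) (F : Fin (r + 1) →
          Submodule (MvPolynomial (Fin n) K) (MvPolynomial (Fin n) K ⧸ I)),
        WeaklyStable.IsCMFiltration (WeaklyStable.stdGrading I) F ∧
        Set.range F = Set.range fun i : Fin (n + 1) =>
          Submodule.map (Submodule.mkQ I) (WeaklyStable.satChain I i)) := by
  refine ⟨?_, hI.exists_isCMFiltration⟩
  by_cases h0 : I = ⊥
  · subst h0
    exact WeaklyStable.isSequentiallyCM_bot
  · obtain ⟨r, F, hF, -⟩ := hI.exists_isCMFiltration h0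
    exact ⟨r, F, hF⟩
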